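/- For a polynomial $f\in\mathbb C[x_1,\dots,x_n]$, $f\neq 0$, let $\mathcal D$ be the ring of algebraic differential operators on $\mathbb C^n$ (the $n$-th Weyl algebra), and let $\mathcal D[s]$ act on the free rank one module $\mathbb C[x_1,\dots,x_n,s][1/f]\cdot f^s$ by $\partial_i(u f^s)=\bigl(\partial_i u+s\,u\,\tfrac{\partial_i f}{f}\bigr)f^s$. The $b$-function (Bernstein–Sato polynomial) $b_f(s)\in\mathbb C[s]$ of $f$ is the monic minimal polynomial of the operator $s$ on the $\mathcal D[s]$-module $\mathcal D[s]f^s/\mathcal D[s]f^{s+1}$, where $f^{s+1}=f\cdot f^s$. For $S\subset\{1,\dots,n\}$ put $\xi_S=\prod_{i<j,\ i,j\in S}(x_i-x_j)$, and let $\xi_n=\xi_{\{1,\dots,n\}}=\prod_{1\le i<j\le n}(x_i-x_j)$ be the Vandermonde determinant. For an integer partition $\lambda=(\lambda_1\ge\dots\ge\lambda_r)$ of $n$ put $\xi_\lambda=\xi_{P_1}\cdots\xi_{P_r}\in\mathbb C[x_1,\dots,x_n]$, where $P_1=\{1,\dots,\lambda_1\}$, $P_2=\{\lambda_1+1,\dots,\lambda_1+\lambda_2\}$,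 and so on. Then, for every integer partition $\lambda$ of $n$, the polynomial $b_{\xi_\lambda}(s)$ divides $b_{\xi_n}(s)$ in $\mathbb C[s]$. -/

import Mathlib

open scoped Polynomial

noncomputable section

namespace BernsteinSato

/-- The defining relations of the `n`-th Weyl algebra: the generator `Sum.inl i` stands for the
coordinate `x i`, and `Sum.inr i` for the partial derivative `∂ i`. -/
inductive WeylRel (n : ℕ) :
    FreeAlgebra ℂ (Fin n ⊕ Fin n) → FreeAlgebra ℂ (Fin n ⊕ Fin n) → Prop
  | x_comm (i j : Fin n) : WeylRel n
      (FreeAlgebra.ι ℂ (Sum.inl i) * FreeAlgebra.ι ℂ (Sum.inl j))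
      (FreeAlgebra.ι ℂ (Sum.inl j) * FreeAlgebra.ι ℂ (Sum.inl i))
  | d_comm (i j : Fin n) : WeylRel n
      (FreeAlgebra.ι ℂ (Sum.inr i) * FreeAlgebra.ι ℂ (Sum.inr j))
      (FreeAlgebra.ι ℂ (Sum.inr j) * FreeAlgebra.ι ℂ (Sum.inr i))
  | d_x (i j : Fin n) : WeylRel n
      (FreeAlgebra.ι ℂ (Sum.inr i) * FreeAlgebra.ι ℂ (Sum.inl j))
      (FreeAlgebra.ι ℂ (Sum.inl j) * FreeAlgebra.ι ℂ (Sum.inr i) + if i = j then 1 else 0)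

/-- The ring of algebraic differential operators on `ℂⁿ`, i.e. the `n`-th Weyl algebra. -/
def WeylAlgebra (n : ℕ) : Type := RingQuot (WeylRel n)

instance (n : ℕ) : Ring (WeylAlgebra n) := RingQuot.instRing (WeylRel n)

instance (n : ℕ) : Algebra ℂ (WeylAlgebra n) := RingQuot.instAlgebra (WeylRel n)

/-- Coordinate functions, as differential operators. -/
def WeylAlgebra.x {n : ℕ} (i : Fin n) : WeylAlgebra n :=
  RingQuot.mkAlgHom ℂ (WeylRel n) (FreeAlgebra.ι ℂ (Sum.inl i))

/-- Partial derivatives, as differential operators. -/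
def WeylAlgebra.d {n : ℕ} (i : Fin n) : WeylAlgebra n :=
  RingQuot.mkAlgHom ℂ (WeylRel n) (FreeAlgebra.ι ℂ (Sum.inr i))

section LocalizedDerivation

variable {k R : Type*} [CommRing k] [CommRing R] [Algebra k R]

/-- For a derivation `D` of `R`, the ring homomorphism `r ↦ r + D(r) ε` to the dual numbers over
`R_f`. -/
def dualHom (D : Derivation k R R) (f : R) :
    R →+* TrivSqZeroExt (Localization.Away f) (Localization.Away f) where
  toFun r := TrivSqZeroExt.inl (algebraMap R (Localization.Away f) r) +
    TrivSqZeroExt.inr (algebraMap R (Localization.Away f) (D r))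
  map_one' := by ext <;> simp
  map_zero' := by ext <;> simp
  map_add' a b := by ext <;> simp [-DualNumber.inr_eq_smul_eps]
  map_mul' a b := by ext <;> simp [-DualNumber.inr_eq_smul_eps, mul_comm]

@[simp]
theorem fst_dualHom (D : Derivation k R R) (f r : R) :
    (dualHom D f r).fst = algebraMap R (Localization.Away f) r := by simp [dualHom]

@[simp]
theorem snd_dualHom (D : Derivation k R R) (f r : R) :
    (dualHom D f r).snd = algebraMap R (Localization.Away f) (D r) := by
  simp [dualHom, -DualNumber.inr_eq_smul_eps]

theorem isUnit_dualHom (D : Derivation k R R) (f : R) : IsUnit (dualHom D f f) :=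
  TrivSqZeroExt.isUnit_iff_isUnit_fst.2 (by
    rw [fst_dualHom]
    exact IsLocalization.Away.algebraMap_isUnit f)

/-- The extension of `dualHom` to `R_f`. -/
def dualLift (D : Derivation k R R) (f : R) :
    Localization.Away f →+* TrivSqZeroExt (Localization.Away f) (Localization.Away f) :=
  IsLocalization.Away.lift f (isUnit_dualHom D f)

theorem dualLift_algebraMap (D : Derivation k R R) (f r : R) :
    dualLift D f (algebraMap R _ r) = dualHom D f r :=
  IsLocalization.Away.lift_eq f (isUnit_dualHom D f) r

theorem fst_dualLift (D : Derivation k R R) (f : R) (a : Localization.Away f) :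
    (dualLift D f a).fst = a := by
  have h : (((TrivSqZeroExt.fstHom (Localization.Away f) (Localization.Away f)
      (Localization.Away f) : _ →+* Localization.Away f)).comp (dualLift D f)) = RingHom.id _ := by
    apply IsLocalization.ringHom_ext (Submonoid.powers f)
    ext r
    simp [dualLift_algebraMap]
  exact congrArg (fun g : Localization.Away f →+* Localization.Away f => g a) h

/-- The unique extension of a derivation of `R` to the localization `R_f`. -/
def localDerivation (D : Derivation k R R) (f : R) :
    Derivation k (Localization.Away f) (Localization.Away f) :=
  Derivation.mk'
    { toFun := fun a => (dualLift D f a).snd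
      map_add' := fun a b => by simp
      map_smul' := fun c a => by
        rw [Algebra.smul_def c a, map_mul, TrivSqZeroExt.snd_mul, fst_dualLift, fst_dualLift,
          IsScalarTower.algebraMap_apply k R, dualLift_algebraMap]
        simp [Algebra.smul_def, ← IsScalarTower.algebraMap_apply k R] }
    (fun a b => by simp [fst_dualLift, mul_comm])

theorem localDerivation_algebraMap (D : Derivation k R R) (f r : R) :
    localDerivation D f (algebraMap R _ r) = algebraMap R _ (D r) := by
  change (dualLift D f (algebraMap R _ r)).snd = _
  rw [dualLift_algebraMap, snd_dualHom]

theorem derivation_eq_zero_of_algebraMap (f : R)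
    (E : Derivation k (Localization.Away f) (Localization.Away f))
    (h : ∀ r : R, E (algebraMap R _ r) = 0) : E = 0 := by
  ext a
  obtain ⟨m, r, hr⟩ := IsLocalization.Away.surj f a
  have h1 := congrArg E hr
  rw [Derivation.leibniz, ← map_pow, h, h, smul_zero, zero_add, smul_eq_mul] at h1
  have hu : IsUnit (algebraMap R (Localization.Away f) (f ^ m)) := by
    rw [map_pow]
    exact (IsLocalization.Away.algebraMap_isUnit f).pow m
  simpa using (hu.mul_right_eq_zero).1 h1

theorem localDerivation_comm (D E : Derivation k R R) (hDE : ∀ r, D (E r) = E (D r)) (f : R)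
    (a : Localization.Away f) :
    localDerivation D f (localDerivation E f a) = localDerivation E f (localDerivation D f a) := by
  have h : ⁅localDerivation D f, localDerivation E f⁆ = 0 := by
    apply derivation_eq_zero_of_algebraMap f
    intro r
    simp [Derivation.commutator_apply, localDerivation_algebraMap, hDE]
  have h2 := congrArg (fun F => F a) h
  simpa [Derivation.commutator_apply, sub_eq_zero] using h2

end LocalizedDerivation

theorem pderiv_comm {n : ℕ} {k : Type*} [CommRing k] (i j : Fin n) (r : MvPolynomial (Fin n) k) :
    MvPolynomial.pderiv i (MvPolynomial.pderiv j r) =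
      MvPolynomial.pderiv j (MvPolynomial.pderiv i r) := by
  have h : ⁅(MvPolynomial.pderiv i : Derivation k (MvPolynomial (Fin n) k) _),
      (MvPolynomial.pderiv j : Derivation k (MvPolynomial (Fin n) k) _)⁆ = 0 := by
    apply MvPolynomial.derivation_ext
    intro l
    rw [Derivation.commutator_apply, MvPolynomial.pderiv_X, MvPolynomial.pderiv_X]
    by_cases h1 : j = l <;> by_cases h2 : i = l <;> simp [h1, h2]
  have h2 := congrArg (fun F => F r) h
  simpa [Derivation.commutator_apply, sub_eq_zero] using h2

variable {n : ℕ}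

/-- The polynomial `f ∈ ℂ[x]` viewed in `ℂ[s][x]`. -/
def extendS (f : MvPolynomial (Fin n) ℂ) : MvPolynomial (Fin n) ℂ[X] :=
  MvPolynomial.map Polynomial.C f

theorem pderiv_extendS (i : Fin n) (f : MvPolynomial (Fin n) ℂ) :
    MvPolynomial.pderiv i (extendS f) = extendS (MvPolynomial.pderiv i f) :=
  MvPolynomial.pderiv_map

/-- The free rank one `ℂ[x, s]_f`-module `ℂ[x, s]_f · f^s`. An element `u · f^s` is represented by
`u ∈ ℂ[x, s]_f`; the variable `s` is `Polynomial.X` in the coefficient ring `ℂ[s]`. -/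
def PowModule (f : MvPolynomial (Fin n) ℂ) : Type := Localization.Away (extendS f)

namespace PowModule

variable (f : MvPolynomial (Fin n) ℂ)

instance : AddCommGroup (PowModule f) := inferInstanceAs (AddCommGroup (Localization.Away _))

instance : Module ℂ[X] (PowModule f) := inferInstanceAs (Module ℂ[X] (Localization.Away _))

instance : Module ℂ (PowModule f) := inferInstanceAs (Module ℂ (Localization.Away _))

instance : IsScalarTower ℂ ℂ[X] (PowModule f) :=
  inferInstanceAs (IsScalarTower ℂ ℂ[X] (Localization.Away _))

/-- The element `u · f^s` for a polynomial `u ∈ ℂ[s][x]`. -/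
def mulPow (u : MvPolynomial (Fin n) ℂ[X]) : PowModule f :=
  (algebraMap _ (Localization.Away (extendS f)) u : Localization.Away (extendS f))

/-- The partial derivative `∂ i` on `ℂ[x, s]_f`, with `∂ i s = 0`. -/
def coeffDeriv (i : Fin n) :
    Derivation ℂ[X] (Localization.Away (extendS f)) (Localization.Away (extendS f)) :=
  localDerivation (MvPolynomial.pderiv i) (extendS f)

/-- The logarithmic derivative `(∂ i f) / f`. -/
def logDeriv (i : Fin n) : Localization.Away (extendS f) :=
  algebraMap _ _ (extendS (MvPolynomial.pderiv i f)) * IsLocalization.Away.invSelf (extendS f)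

/-- Multiplication by `x i`: `u f^s ↦ (x i u) f^s`. -/
def xOp (i : Fin n) : Module.End ℂ[X] (Localization.Away (extendS f)) :=
  LinearMap.mulLeft ℂ[X] (algebraMap (MvPolynomial (Fin n) ℂ[X]) _ (MvPolynomial.X i))

/-- The action of `∂ i` dictated by the Leibniz and chain rules:
`u f^s ↦ (∂ i u + s u (∂ i f) / f) f^s`. -/
def dOp (i : Fin n) : Module.End ℂ[X] (Localization.Away (extendS f)) :=
  (coeffDeriv f i).toLinearMap +
    (Polynomial.X : ℂ[X]) • LinearMap.mulLeft ℂ[X] (logDeriv f i)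

theorem dOp_apply (i : Fin n) (u : Localization.Away (extendS f)) :
    dOp f i u = coeffDeriv f i u + (Polynomial.X : ℂ[X]) • (logDeriv f i * u) := rfl

theorem coeffDeriv_algebraMap (i : Fin n) (r : MvPolynomial (Fin n) ℂ[X]) :
    coeffDeriv f i (algebraMap _ _ r) = algebraMap _ _ (MvPolynomial.pderiv i r) :=
  localDerivation_algebraMap _ _ _

theorem coeffDeriv_comm (i j : Fin n) (u : Localization.Away (extendS f)) :
    coeffDeriv f i (coeffDeriv f j u) = coeffDeriv f j (coeffDeriv f i u) := by
  exact localDerivation_comm _ _ (pderiv_comm i j) _ _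

theorem logDeriv_mul (i : Fin n) :
    logDeriv f i * algebraMap (MvPolynomial (Fin n) ℂ[X]) _ (extendS f) =
      algebraMap _ (Localization.Away (extendS f)) (extendS (MvPolynomial.pderiv i f)) := by
  rw [logDeriv, mul_assoc, mul_comm (IsLocalization.Away.invSelf _),
    IsLocalization.Away.mul_invSelf, mul_one]

theorem coeffDeriv_logDeriv_comm (i j : Fin n) :
    coeffDeriv f i (logDeriv f j) = coeffDeriv f j (logDeriv f i) := by
  have key : ∀ i j : Fin n, coeffDeriv f i (logDeriv f j) * algebraMap _ _ (extendS f) +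
      logDeriv f j * logDeriv f i * algebraMap (MvPolynomial (Fin n) ℂ[X]) _ (extendS f) =
        algebraMap _ (Localization.Away (extendS f))
          (extendS (MvPolynomial.pderiv i (MvPolynomial.pderiv j f))) := by
    intro i j
    have h := congrArg (coeffDeriv f i) (logDeriv_mul f j)
    rw [Derivation.leibniz, coeffDeriv_algebraMap, coeffDeriv_algebraMap, pderiv_extendS,
      pderiv_extendS, ← logDeriv_mul f i, smul_eq_mul, smul_eq_mul] at h
    rw [← h]
    ring
  have h1 := key i j
  rw [pderiv_comm, ← key j i, mul_comm (logDeriv f j)] at h1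
  exact (IsLocalization.Away.algebraMap_isUnit (extendS f)).mul_left_injective
    (add_right_cancel h1)

/-- The action of the Weyl algebra on `ℂ[x, s]_f · f^s`. -/
def weylAction : WeylAlgebra n →ₐ[ℂ] Module.End ℂ[X] (Localization.Away (extendS f)) :=
  RingQuot.liftAlgHom ℂ ⟨FreeAlgebra.lift ℂ (Sum.elim (xOp f) (dOp f)), by
    intro a b hab
    induction hab with
    | x_comm i j =>
      ext u
      simp [xOp, mul_left_comm]
    | d_comm i j =>
      apply LinearMap.ext
      intro u
      simp only [map_mul, FreeAlgebra.lift_ι_apply, Sum.elim_inr, Module.End.mul_apply, dOp_apply,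
        map_add, Derivation.map_smul, Derivation.leibniz, coeffDeriv_comm f i j,
        coeffDeriv_logDeriv_comm f i j, smul_eq_mul]
      simp only [Algebra.smul_def]
      ring
    | d_x i j =>
      apply LinearMap.ext
      intro u
      simp only [map_mul, map_add, FreeAlgebra.lift_ι_apply, Sum.elim_inr, Sum.elim_inl,
        Module.End.mul_apply, dOp_apply, LinearMap.add_apply, xOp, LinearMap.mulLeft_apply,
        Derivation.leibniz, coeffDeriv_algebraMap, MvPolynomial.pderiv_X, smul_eq_mul,
        Algebra.smul_def]
      by_cases h : i = j
      · subst h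
        simp
        ring
      · simp [h, Ne.symm h]
        ring⟩

/-- The action of `D[s]` on `ℂ[x, s]_f · f^s`, where `D` is the Weyl algebra and `s`
(`Polynomial.X`) acts as multiplication by `s`. -/
def action : (WeylAlgebra n)[X] →+* Module.End ℂ[X] (Localization.Away (extendS f)) :=
  Polynomial.eval₂RingHom' (weylAction f : WeylAlgebra n →+* _)
    (algebraMap ℂ[X] _ Polynomial.X) fun a => (Algebra.commutes Polynomial.X (weylAction f a)).symm

instance : Module (WeylAlgebra n)[X] (PowModule f) :=
  Module.compHom (Localization.Away (extendS f)) (action f)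

theorem smul_def (P : (WeylAlgebra n)[X]) (u : PowModule f) : P • u = action f P u := rfl

theorem algebraMap_smul (c : ℂ) (u : PowModule f) :
    algebraMap ℂ (WeylAlgebra n)[X] c • u = c • u := by
  rw [smul_def, action, Polynomial.algebraMap_apply]
  simp only [Polynomial.eval₂RingHom', RingHom.coe_mk, MonoidHom.coe_mk, OneHom.coe_mk,
    Polynomial.eval₂_C]
  rw [AlgHom.coe_toRingHom, AlgHom.commutes]
  rfl

instance : IsScalarTower ℂ (WeylAlgebra n)[X] (PowModule f) :=
  IsScalarTower.of_algebraMap_smul (algebraMap_smul f)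

end PowModule

section BFunction

variable (f : MvPolynomial (Fin n) ℂ)

/-- The `D[s]`-submodule `D[s] f^s` of `ℂ[x, s]_f · f^s`. -/
def cyclicModule : Submodule (WeylAlgebra n)[X] (PowModule f) :=
  Submodule.span _ {PowModule.mulPow f 1}

/-- The `D[s]`-submodule `D[s] f^(s+1)`, where `f^(s+1) = f · f^s`. -/
def cyclicModuleSucc : Submodule (WeylAlgebra n)[X] (PowModule f) :=
  Submodule.span _ {PowModule.mulPow f (extendS f)}

/-- The `D[s]`-module `D[s] f^s / D[s] f^(s+1)`. -/
abbrev BSQuotient : Type := cyclicModule f ⧸ (cyclicModuleSucc f).submoduleOf (cyclicModule f)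

/-- The `b`-function (Bernstein-Sato polynomial) of `f`: the monic minimal polynomial over `ℂ` of
the operator `s` on `D[s] f^s / D[s] f^(s+1)`. -/
def bFunction : ℂ[X] :=
  minpoly ℂ (Algebra.lsmul ℂ ℂ (BSQuotient f) (Polynomial.X : (WeylAlgebra n)[X]))

end BFunction

/-- `ξ_S`, the product of the `x i - x j` over the pairs `i < j` in `S`. -/
def xiSet (S : Finset (Fin n)) : MvPolynomial (Fin n) ℂ :=
  ∏ p ∈ (S ×ˢ S).filter (fun p => p.1 < p.2), (MvPolynomial.X p.1 - MvPolynomial.X p.2)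

/-- The Vandermonde determinant `ξ_n`, the product of all `x i - x j` with `i < j`. -/
def xi (n : ℕ) : MvPolynomial (Fin n) ℂ := xiSet Finset.univ

/-- The parts `λ₁ ≥ λ₂ ≥ …` of an integer partition of `n`, in decreasing order. -/
def sortedParts (l : n.Partition) : Composition n where
  blocks := l.parts.sort (· ≥ ·)
  blocks_pos h := l.parts_pos ((Multiset.mem_sort _).1 h)
  blocks_sum := by
    rw [← Multiset.sum_coe, Multiset.sort_eq, l.parts_sum]

/-- The `t`-th block of the set partition of an `n`-element set attached to `λ`: the first `λ₁`
elements form the first block, the next `λ₂` elements the second one, and so on. -/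
def block (l : n.Partition) (t : Fin (sortedParts l).length) : Finset (Fin n) :=
  Finset.univ.map ((sortedParts l).embedding t).toEmbedding

/-- `ξ_λ`, the product of the `ξ_S` over the blocks `S` of the set partition attached to `λ`. -/
def xiPartition (l : n.Partition) : MvPolynomial (Fin n) ℂ :=
  ∏ t : Fin (sortedParts l).length, xiSet (block l t)

end BernsteinSato

end

/-! Write `ξ_n = g * u`, where `g = ξ_λ` collects the factors `x i - x j` with both indices in one
block and `u` the remaining ones. Suppose `b(s) (g u)^s = P (g u)^(s+1)` with `P ∈ D[s]`.

Where `u` is invertible, conjugation by `u^s` turns `∂ i` into `∂ i + s (∂ i u) / u`, so the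
relation becomes one about `g^s` up to denominators in `u`. Clearing them gives `u^N b(s) g^s ∈ D[s]
g^(s+1)` for some `N` (`exists_pow_mul_mem`).

To remove `u^N`, take the constant vector field `v` whose `i`-th coefficient is the index of the
block containing `i`. It kills `g`, hence `v (h b(s) g^s) = v(h) b(s) g^s` (`dirDeriv_mul_mem`), and
it sends each linear factor of `u` to a nonzero constant. Applying `v` as many times as `u^N` has
linear factors leaves a nonzero constant (`iterate_derivation_prod`), so `b(s) g^s ∈ D[s] g^(s+1)`.
Thus every `b` valid for `ξ_n` is valid for `ξ_λ`, which is divisibility of minimal polynomials. -/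

noncomputable section

namespace BernsteinSato

variable {n : ℕ}

/-! ### The `D[s]`-action and submodules stable under it -/

namespace PowModule

variable (f : MvPolynomial (Fin n) ℂ)

theorem action_C (a : WeylAlgebra n) : action f (Polynomial.C a) = weylAction f a := by
  simp [action, Polynomial.eval₂RingHom']

theorem action_X : action f Polynomial.X = algebraMap ℂ[X] _ Polynomial.X := by
  simp [action, Polynomial.eval₂RingHom']

theorem weylAction_mkAlgHom (a : FreeAlgebra ℂ (Fin n ⊕ Fin n)) :
    weylAction f (RingQuot.mkAlgHom ℂ (WeylRel n) a) =
      FreeAlgebra.lift ℂ (Sum.elim (xOp f) (dOp f)) a :=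
  RingQuot.liftAlgHom_mkAlgHom_apply ..

theorem weylAction_x (i : Fin n) : weylAction f (WeylAlgebra.x i) = xOp f i :=
  (weylAction_mkAlgHom f _).trans (by simp)

theorem weylAction_d (i : Fin n) : weylAction f (WeylAlgebra.d i) = dOp f i :=
  (weylAction_mkAlgHom f _).trans (by simp)

theorem action_map (c : ℂ[X]) :
    action f (c.map (algebraMap ℂ (WeylAlgebra n))) =
      algebraMap ℂ[X] (Module.End ℂ[X] (Localization.Away (extendS f))) c := by
  induction c using Polynomial.induction_on with
  | C a =>
    rw [Polynomial.map_C, action_C, AlgHom.commutes, IsScalarTower.algebraMap_apply ℂ ℂ[X]]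
    rfl
  | add p q hp hq => rw [Polynomial.map_add, map_add, map_add, hp, hq]
  | monomial k a ih =>
    rw [pow_succ, ← mul_assoc, Polynomial.map_mul, map_mul, ih, Polynomial.map_X, action_X,
      ← map_mul]

variable {f}

/-- A `ℂ[s]`-submodule of `ℂ[x, s]_f · f^s` stable under the coordinates and the partial
derivatives. -/
structure IsStable (S : Submodule ℂ[X] (Localization.Away (extendS f))) : Prop where
  xOp_mem : ∀ i, ∀ w ∈ S, xOp f i w ∈ S
  dOp_mem : ∀ i, ∀ w ∈ S, dOp f i w ∈ S

namespace IsStable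

variable {S : Submodule ℂ[X] (Localization.Away (extendS f))} (hS : IsStable S)
include hS

theorem weylAction_mem (a : WeylAlgebra n) :
    ∀ w ∈ S, weylAction f a w ∈ S := by
  obtain ⟨a, rfl⟩ := RingQuot.mkAlgHom_surjective ℂ (WeylRel n) a
  rw [weylAction_mkAlgHom]
  induction a using FreeAlgebra.induction with
  | grade0 r =>
    intro w hw
    rw [AlgHom.commutes, Module.algebraMap_end_apply, ← _root_.algebraMap_smul ℂ[X] r w]
    exact S.smul_mem _ hw
  | grade1 i =>
    intro w hw
    rcases i with i | i
    · simpa using hS.xOp_mem i w hw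
    · simpa using hS.dOp_mem i w hw
  | mul a b ha hb =>
    intro w hw
    rw [map_mul]
    exact ha _ (hb _ hw)
  | add a b ha hb =>
    intro w hw
    rw [map_add]
    exact S.add_mem (ha _ hw) (hb _ hw)

theorem action_mem (P : (WeylAlgebra n)[X]) {w : Localization.Away (extendS f)} (hw : w ∈ S) :
    action f P w ∈ S := by
  induction P using Polynomial.induction_on' with
  | add p q hp hq => rw [map_add]; exact S.add_mem hp hq
  | monomial k a =>
    rw [← Polynomial.C_mul_X_pow_eq_monomial, map_mul, map_pow, action_C, action_X, ← map_pow,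
      Module.End.mul_apply, Module.algebraMap_end_apply]
    exact hS.weylAction_mem a _ (S.smul_mem _ hw)

theorem algebraMap_mul_mem (r : MvPolynomial (Fin n) ℂ[X]) {w : Localization.Away (extendS f)}
    (hw : w ∈ S) : algebraMap _ (Localization.Away (extendS f)) r * w ∈ S := by
  induction r using MvPolynomial.induction_on with
  | C c =>
    rw [← MvPolynomial.algebraMap_eq, ← IsScalarTower.algebraMap_apply, ← Algebra.smul_def]
    exact S.smul_mem c hw
  | add p q hp hq => rw [map_add, add_mul]; exact S.add_mem hp hq
  | mul_X p i hp =>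
    rw [mul_comm p, map_mul, mul_assoc]
    exact hS.xOp_mem i _ hp

end IsStable

variable (f)

/-- The `ℂ[s]`-submodule of `ℂ[x, s]_f` underlying `D[s] f^(s+1)`. -/
def succSubmodule : Submodule ℂ[X] (Localization.Away (extendS f)) where
  carrier := {w | ∃ P, action f P (algebraMap _ _ (extendS f)) = w}
  zero_mem' := ⟨0, by simp⟩
  add_mem' := by
    rintro _ _ ⟨P, rfl⟩ ⟨Q, rfl⟩
    exact ⟨P + Q, by simp⟩
  smul_mem' := by
    rintro c _ ⟨P, rfl⟩
    exact ⟨c.map (algebraMap ℂ (WeylAlgebra n)) * P, by simp [action_map]⟩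

theorem isStable_succSubmodule : IsStable (succSubmodule f) where
  xOp_mem := by
    rintro i _ ⟨P, rfl⟩
    exact ⟨Polynomial.C (WeylAlgebra.x i) * P, by simp [action_C, weylAction_x]⟩
  dOp_mem := by
    rintro i _ ⟨P, rfl⟩
    exact ⟨Polynomial.C (WeylAlgebra.d i) * P, by simp [action_C, weylAction_d]⟩

theorem self_mem_succSubmodule : algebraMap _ _ (extendS f) ∈ succSubmodule f := ⟨1, by simp⟩

theorem mem_cyclicModuleSucc {w : PowModule f} :
    w ∈ cyclicModuleSucc f ↔ (w : Localization.Away (extendS f)) ∈ succSubmodule f :=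
  Submodule.mem_span_singleton

theorem dOp_algebraMap_mul (i : Fin n) (r : MvPolynomial (Fin n) ℂ[X])
    (a : Localization.Away (extendS f)) :
    dOp f i (algebraMap _ _ r * a) =
      algebraMap _ _ r * dOp f i a + algebraMap _ _ (MvPolynomial.pderiv i r) * a := by
  simp only [dOp_apply, Derivation.leibniz, coeffDeriv_algebraMap, smul_eq_mul, Algebra.smul_def]
  ring

end PowModule

/-! ### Passing from `(g u)^s` to `g^s` -/

section Transfer

open PowModule

variable (f g u : MvPolynomial (Fin n) ℂ)

theorem extendS_mul : extendS (f * g) = extendS f * extendS g := map_mul _ _ _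

theorem extendS_pow (N : ℕ) : extendS (f ^ N) = extendS f ^ N := map_pow _ _ _

theorem extendS_ne_zero {f : MvPolynomial (Fin n) ℂ} (hf : f ≠ 0) : extendS f ≠ 0 := by
  intro h
  apply hf
  apply MvPolynomial.map_injective _ Polynomial.C_injective
  rw [map_zero]
  exact h

theorem isUnit_algebraMap_left :
    IsUnit (algebraMap _ (Localization.Away (extendS (g * u))) (extendS g)) := by
  have h := IsLocalization.Away.algebraMap_isUnit (S := Localization.Away (extendS (g * u)))
    (extendS (g * u))
  have e : algebraMap _ (Localization.Away (extendS (g * u))) (extendS (g * u)) =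
      algebraMap _ _ (extendS g) * algebraMap _ _ (extendS u) := by
    rw [← map_mul, ← extendS_mul]
  rw [e] at h
  exact isUnit_of_mul_isUnit_left h

/-- The localization map `ℂ[x, s]_g → ℂ[x, s]_{g u}`. -/
def locMap : Localization.Away (extendS g) →+* Localization.Away (extendS (g * u)) :=
  IsLocalization.Away.lift (extendS g) (isUnit_algebraMap_left g u)

@[simp]
theorem locMap_algebraMap (r : MvPolynomial (Fin n) ℂ[X]) :
    locMap g u (algebraMap _ _ r) = algebraMap _ _ r :=
  IsLocalization.Away.lift_eq _ (isUnit_algebraMap_left g u) r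

theorem locMap_smul (c : ℂ[X]) (a : Localization.Away (extendS g)) :
    locMap g u (c • a) = c • locMap g u a := by
  rw [Algebra.smul_def, Algebra.smul_def, map_mul,
    IsScalarTower.algebraMap_apply ℂ[X] (MvPolynomial (Fin n) ℂ[X]), locMap_algebraMap,
    ← IsScalarTower.algebraMap_apply]

-- Since `g * u ≠ 0`, polynomials embed in the larger localization; this lets identities found there
-- be pulled back to `ℂ[x, s]_g`.
variable {g u} in
theorem locMap_injective (h : g * u ≠ 0) : Function.Injective (locMap g u) := by
  rw [injective_iff_map_eq_zero]
  intro a ha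
  obtain ⟨m, r, hr⟩ := IsLocalization.Away.surj (extendS g) a
  have h1 := congrArg (locMap g u) hr
  rw [map_mul, ha, zero_mul, locMap_algebraMap] at h1
  have h2 : r = 0 := by
    apply IsLocalization.injective (Localization.Away (extendS (g * u)))
      (powers_le_nonZeroDivisors_of_noZeroDivisors (extendS_ne_zero h))
    rw [← h1, map_zero]
  rw [h2, map_zero] at hr
  exact (((IsLocalization.Away.algebraMap_isUnit (extendS g)).pow m).mul_left_eq_zero).1 hr

theorem locMap_coeffDeriv (i : Fin n) (a : Localization.Away (extendS g)) :
    locMap g u (coeffDeriv g i a) = coeffDeriv (g * u) i (locMap g u a) := by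
  obtain ⟨m, r, hr⟩ := IsLocalization.Away.surj (extendS g) a
  rw [← map_pow] at hr
  have h1 := congrArg (locMap g u) (congrArg (coeffDeriv g i) hr)
  have h2 := congrArg (coeffDeriv (g * u) i) (congrArg (locMap g u) hr)
  rw [map_mul] at h2
  simp only [Derivation.leibniz, coeffDeriv_algebraMap, map_add, map_mul, smul_eq_mul,
    locMap_algebraMap] at h1 h2
  have h3 := add_left_cancel (h1.trans h2.symm)
  rw [map_pow] at h3
  exact ((isUnit_algebraMap_left g u).pow m).mul_right_injective h3

theorem locMap_logDeriv (i : Fin n) :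
    algebraMap _ _ (extendS u) * logDeriv (g * u) i =
      algebraMap _ _ (extendS u) * locMap g u (logDeriv g i) +
        algebraMap _ _ (extendS (MvPolynomial.pderiv i u)) := by
  have h1 := logDeriv_mul (g * u) i
  have h2 := congrArg (locMap g u) (logDeriv_mul g i)
  simp only [map_mul, locMap_algebraMap] at h2
  have e1 : algebraMap _ (Localization.Away (extendS (g * u))) (extendS (g * u)) =
      algebraMap _ _ (extendS g) * algebraMap _ _ (extendS u) := by
    rw [← map_mul, ← extendS_mul]
  have e2 : algebraMap _ (Localization.Away (extendS (g * u)))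
      (extendS (MvPolynomial.pderiv i (g * u))) =
      algebraMap _ _ (extendS g) * algebraMap _ _ (extendS (MvPolynomial.pderiv i u)) +
      algebraMap _ _ (extendS u) * algebraMap _ _ (extendS (MvPolynomial.pderiv i g)) := by
    rw [← map_mul, ← map_mul, ← map_add, ← extendS_mul, ← extendS_mul, Derivation.leibniz]
    exact congrArg _ (map_add (MvPolynomial.map Polynomial.C) _ _)
  rw [e1, e2] at h1
  apply (isUnit_algebraMap_left g u).mul_left_injective
  simp only
  linear_combination h1 - algebraMap _ _ (extendS u) * h2

/-- The conjugation rule `u^(-s) ∂ i u^s = ∂ i + s (∂ i u) / u`, multiplied by `u` so that the right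
side stays in `ℂ[x, s]_g`. Here `locMap` plays the role of `m g^s ↦ m (g u)^s`. -/
theorem locMap_dOp (i : Fin n) (a : Localization.Away (extendS g)) :
    algebraMap _ _ (extendS u) * dOp (g * u) i (locMap g u a) =
      locMap g u (algebraMap _ _ (extendS u) * dOp g i a +
        (Polynomial.X : ℂ[X]) • (algebraMap _ _ (extendS (MvPolynomial.pderiv i u)) * a)) := by
  have h := locMap_logDeriv g u i
  simp only [dOp_apply, map_add, map_mul, locMap_smul, locMap_coeffDeriv, locMap_algebraMap]
  simp only [Algebra.smul_def]
  linear_combination (algebraMap ℂ[X] _ Polynomial.X * locMap g u a) * h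

variable {g}

/-- The elements of `ℂ[x, s]_{g u}` that a power of `u` moves into `S`. -/
def saturation {S : Submodule ℂ[X] (Localization.Away (extendS g))} (hS : IsStable S) :
    Submodule ℂ[X] (Localization.Away (extendS (g * u))) where
  carrier := {w | ∃ N : ℕ, ∃ m ∈ S, algebraMap _ _ (extendS u) ^ N * w = locMap g u m}
  zero_mem' := ⟨0, 0, S.zero_mem, by simp⟩
  add_mem' := by
    rintro a b ⟨N, m, hm, ha⟩ ⟨K, k, hk, hb⟩
    refine ⟨N + K, _, S.add_mem (hS.algebraMap_mul_mem (extendS u ^ K) hm)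
      (hS.algebraMap_mul_mem (extendS u ^ N) hk), ?_⟩
    rw [map_add, map_mul, map_mul, locMap_algebraMap, locMap_algebraMap, ← ha, ← hb, map_pow,
      map_pow]
    ring
  smul_mem' := by
    rintro c a ⟨N, m, hm, ha⟩
    refine ⟨N, _, S.smul_mem c hm, ?_⟩
    rw [locMap_smul, ← ha, mul_smul_comm]

theorem isStable_saturation {S : Submodule ℂ[X] (Localization.Away (extendS g))}
    (hS : IsStable S) : IsStable (saturation u hS) where
  xOp_mem := by
    rintro i w ⟨N, m, hm, h⟩
    refine ⟨N, _, hS.algebraMap_mul_mem (MvPolynomial.X i) hm, ?_⟩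
    rw [map_mul, locMap_algebraMap, ← h, xOp, LinearMap.mulLeft_apply]
    ring
  dOp_mem := by
    rintro i w ⟨N, m, hm, h⟩
    have h1 := hS.algebraMap_mul_mem (extendS u) (hS.dOp_mem i m hm)
    have h2 := S.smul_mem Polynomial.X
      (hS.algebraMap_mul_mem (extendS (MvPolynomial.pderiv i u)) hm)
    have h3 := hS.algebraMap_mul_mem
      ((N : MvPolynomial (Fin n) ℂ[X]) * extendS (MvPolynomial.pderiv i u)) hm
    -- From `u^N w = m`, Leibniz gives `u^(N+1) ∂ i w = u ∂ i m - N (∂ i u) m` with `∂ i` acting as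
    -- on `(g u)^s`; the extra factor `u` is the one `locMap_dOp` needs.
    refine ⟨N + 1, _, S.sub_mem (S.add_mem h1 h2) h3, ?_⟩
    rw [map_sub, ← locMap_dOp g u i m, ← h, ← map_pow, ← map_pow, dOp_algebraMap_mul,
      Derivation.leibniz_pow, pderiv_extendS, map_mul (locMap g u), locMap_algebraMap, ← h]
    -- `Derivation.leibniz_pow` contains the truncated exponent `N - 1`.
    rcases N with _ | N
    · simp
    · simp only [map_pow, nsmul_eq_mul, map_mul, map_natCast, smul_eq_mul, Nat.add_sub_cancel]
      ring

variable {u}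

/-- The saturation of `D[s] g^(s+1)` is stable and contains the generator `(g u)^(s+1)`, hence all
of `D[s] (g u)^(s+1)`, and in particular `b(s) (g u)^s`. -/
theorem exists_pow_mul_mem (h : g * u ≠ 0) (c : ℂ[X])
    (hc : algebraMap ℂ[X] _ c ∈ succSubmodule (g * u)) :
    ∃ N : ℕ, algebraMap _ (Localization.Away (extendS g)) (extendS (u ^ N)) *
      algebraMap ℂ[X] _ c ∈ succSubmodule g := by
  obtain ⟨P, hP⟩ := hc
  have hg := isStable_succSubmodule g
  have hmem : algebraMap _ _ (extendS (g * u)) ∈ saturation u hg := by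
    refine ⟨0, _, hg.algebraMap_mul_mem (extendS u) (self_mem_succSubmodule g), ?_⟩
    rw [← map_mul, locMap_algebraMap, extendS_mul, mul_comm (extendS u), pow_zero, one_mul]
  have h1 := (isStable_saturation u hg).action_mem P hmem
  rw [hP] at h1
  obtain ⟨N, m, hm, e⟩ := h1
  refine ⟨N, ?_⟩
  convert hm using 1
  apply locMap_injective h
  rw [← e, map_mul, locMap_algebraMap, extendS_pow, map_pow,
    IsScalarTower.algebraMap_apply ℂ[X] (MvPolynomial (Fin n) ℂ[X]), locMap_algebraMap,
    ← IsScalarTower.algebraMap_apply]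

end Transfer

/-! ### The `b`-function through membership in `D[s] f^(s+1)` -/

section Annihilator

open PowModule

variable (f : MvPolynomial (Fin n) ℂ)

theorem aeval_lsmul_apply (b : ℂ[X]) (q : BSQuotient f) :
    Polynomial.aeval (Algebra.lsmul ℂ ℂ (BSQuotient f) (Polynomial.X : (WeylAlgebra n)[X])) b q =
      b.map (algebraMap ℂ (WeylAlgebra n)) • q := by
  have h : Polynomial.aeval (Polynomial.X : (WeylAlgebra n)[X]) b =
      b.map (algebraMap ℂ (WeylAlgebra n)) := by
    rw [Polynomial.aeval_def, Polynomial.map]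
    rfl
  rw [Polynomial.aeval_algHom_apply, Algebra.lsmul_coe, h]

theorem map_smul_mk_eq_zero_iff (b : ℂ[X]) (q : cyclicModule f) :
    b.map (algebraMap ℂ (WeylAlgebra n)) • (Submodule.Quotient.mk q : BSQuotient f) = 0 ↔
      b • (q.1 : Localization.Away (extendS f)) ∈ succSubmodule f := by
  rw [← Submodule.Quotient.mk_smul, Submodule.Quotient.mk_eq_zero]
  change (b.map (algebraMap ℂ (WeylAlgebra n)) • q.1 : PowModule f) ∈ cyclicModuleSucc f ↔ _
  rw [mem_cyclicModuleSucc, smul_def, action_map]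
  rfl

theorem smul_mulPow_one (b : ℂ[X]) :
    (b • mulPow f 1 : PowModule f) = algebraMap ℂ[X] (Localization.Away (extendS f)) b := by
  rw [Algebra.algebraMap_eq_smul_one,
    ← map_one (algebraMap (MvPolynomial (Fin n) ℂ[X]) (Localization.Away (extendS f)))]
  rfl

/-- As `s` is central in `D[s]`, a polynomial in `s` kills the cyclic quotient as soon as it kills
the class of `f^s`. -/
theorem aeval_lsmul_eq_zero_iff (b : ℂ[X]) :
    Polynomial.aeval (Algebra.lsmul ℂ ℂ (BSQuotient f) (Polynomial.X : (WeylAlgebra n)[X])) b = 0 ↔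
      algebraMap ℂ[X] _ b ∈ succSubmodule f := by
  have hgen : mulPow f 1 ∈ cyclicModule f := Submodule.mem_span_singleton_self _
  rw [← smul_mulPow_one]
  constructor
  · intro h
    have h1 := LinearMap.congr_fun h (Submodule.Quotient.mk ⟨mulPow f 1, hgen⟩)
    rw [aeval_lsmul_apply, LinearMap.zero_apply, map_smul_mk_eq_zero_iff] at h1
    exact h1
  · intro h
    apply LinearMap.ext
    intro q
    obtain ⟨⟨w, hw⟩, rfl⟩ := Submodule.Quotient.mk_surjective _ q
    obtain ⟨P, rfl⟩ := Submodule.mem_span_singleton.1 hw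
    rw [aeval_lsmul_apply, LinearMap.zero_apply, map_smul_mk_eq_zero_iff]
    have h2 := (isStable_succSubmodule f).action_mem P h
    have e := (action f P).map_smul b (mulPow f 1)
    exact e ▸ h2

/-- Existence of a nonzero `b`-function is not needed: without one, `minpoly` is `0` by convention
and the argument still applies. -/
theorem bFunction_dvd_bFunction_of_mem {m : ℕ} {f : MvPolynomial (Fin n) ℂ}
    {g : MvPolynomial (Fin m) ℂ}
    (h : ∀ b : ℂ[X], algebraMap ℂ[X] _ b ∈ succSubmodule f →
      algebraMap ℂ[X] _ b ∈ succSubmodule g) : bFunction g ∣ bFunction f :=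
  minpoly.dvd _ _ ((aeval_lsmul_eq_zero_iff g _).2
    (h _ ((aeval_lsmul_eq_zero_iff f _).1 (minpoly.aeval _ _))))

end Annihilator

/-! ### Iterated derivations of products of linear forms -/

section Derivations

variable {k R ι : Type*} [CommRing k] [CommRing R] [Algebra k R] (D : Derivation k R R)

/-- In the higher Leibniz formula only two terms survive, because `D (D a) = 0`. -/
theorem iterate_derivation_mul_of_eq_const (a h : R) (c : k) (ha : D a = algebraMap k R c)
    (m : ℕ) : D^[m + 1] (a * h) =
      a * D^[m + 1] h + algebraMap k R ((m + 1 : ℕ) * c) * D^[m] h := by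
  induction m with
  | zero => simp [ha, mul_comm]
  | succ m ih =>
    rw [Function.iterate_succ_apply', ih, map_add, Derivation.leibniz, Derivation.leibniz,
      Derivation.map_algebraMap, ha, Function.iterate_succ_apply' D (m + 1),
      Function.iterate_succ_apply' D m]
    simp only [smul_eq_mul, map_mul, map_natCast]
    push_cast
    ring

theorem iterate_derivation_prod (s : Finset ι) (L : ι → R) (c : ι → k)
    (hL : ∀ i ∈ s, D (L i) = algebraMap k R (c i)) :
    D^[s.card] (∏ i ∈ s, L i) = algebraMap k R (s.card.factorial * ∏ i ∈ s, c i) := by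
  classical
  induction s using Finset.induction_on with
  | empty => simp
  | insert i s hi ih =>
    have ih := ih fun j hj => hL j (Finset.mem_insert_of_mem hj)
    -- By induction `D^[s.card]` of the product over `s` is constant, so one more derivative kills
    -- the first Leibniz term; the second supplies the factor `(s.card + 1) * c i`.
    rw [Finset.prod_insert hi, Finset.prod_insert hi, Finset.card_insert_of_notMem hi,
      iterate_derivation_mul_of_eq_const D _ _ (c i) (hL i (Finset.mem_insert_self _ _)),
      Function.iterate_succ_apply', ih, Derivation.map_algebraMap, Nat.factorial_succ]
    simp only [map_mul, map_natCast]
    push_cast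
    ring

theorem derivation_prod_eq_zero (s : Finset ι) (L : ι → R) (hL : ∀ i ∈ s, D (L i) = 0) :
    D (∏ i ∈ s, L i) = 0 :=
  Finset.prod_induction L (fun r => D r = 0) (fun a b ha hb => by simp [ha, hb]) (by simp) hL

end Derivations

/-- The directional derivative along the constant vector field `v`. -/
def dirDeriv (v : Fin n → ℂ) :
    Derivation ℂ (MvPolynomial (Fin n) ℂ) (MvPolynomial (Fin n) ℂ) :=
  ∑ i, v i • MvPolynomial.pderiv i

theorem dirDeriv_apply (v : Fin n → ℂ) (h : MvPolynomial (Fin n) ℂ) :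
    dirDeriv v h = ∑ i, v i • MvPolynomial.pderiv i h := by
  rw [dirDeriv, ← Derivation.coeFnAddMonoidHom_apply, map_sum, Finset.sum_apply]
  rfl

theorem dirDeriv_X (v : Fin n → ℂ) (j : Fin n) :
    dirDeriv v (MvPolynomial.X j) = MvPolynomial.C (v j) := by
  classical
  rw [dirDeriv_apply, Finset.sum_eq_single j]
  · simp [MvPolynomial.smul_eq_C_mul]
  · intro i _ hij
    simp [MvPolynomial.pderiv_X_of_ne hij.symm]
  · simp

theorem extendS_zero : extendS (0 : MvPolynomial (Fin n) ℂ) = 0 := map_zero _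

theorem extendS_C (a : ℂ) : extendS (MvPolynomial.C a : MvPolynomial (Fin n) ℂ) =
    algebraMap ℂ[X] _ (Polynomial.C a) := MvPolynomial.map_C _ _

theorem extendS_sum {ι : Type*} (s : Finset ι) (h : ι → MvPolynomial (Fin n) ℂ) :
    extendS (∑ i ∈ s, h i) = ∑ i ∈ s, extendS (h i) := map_sum (MvPolynomial.map Polynomial.C) _ _

/-! ### Removing the power of `u` by a constant vector field -/

section Divisibility

open PowModule

variable {g : MvPolynomial (Fin n) ℂ}

theorem algebraMap_extendS_dirDeriv (v : Fin n → ℂ) (h : MvPolynomial (Fin n) ℂ) :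
    algebraMap _ (Localization.Away (extendS g)) (extendS (dirDeriv v h)) =
      ∑ i, (Polynomial.C (v i) : ℂ[X]) •
        algebraMap _ (Localization.Away (extendS g)) (extendS (MvPolynomial.pderiv i h)) := by
  rw [dirDeriv_apply, extendS_sum, map_sum]
  refine Finset.sum_congr rfl fun i _ => ?_
  rw [MvPolynomial.smul_eq_C_mul, extendS_mul, extendS_C, map_mul,
    ← IsScalarTower.algebraMap_apply, ← Algebra.smul_def]

theorem sum_smul_logDeriv_eq_zero {v : Fin n → ℂ} (hv : dirDeriv v g = 0) :
    ∑ i, (Polynomial.C (v i) : ℂ[X]) • logDeriv g i = 0 := by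
  apply (IsLocalization.Away.algebraMap_isUnit (S := Localization.Away (extendS g))
    (extendS g)).mul_left_injective
  have h := algebraMap_extendS_dirDeriv (g := g) v g
  rw [hv, extendS_zero, map_zero] at h
  simp only [zero_mul, Finset.sum_mul, smul_mul_assoc, logDeriv_mul]
  exact h.symm

/-- The field `v` acts on `g^s` through `s * v(g) / g = 0`, so it differentiates the coefficient
alone. -/
theorem dirDeriv_mul_mem {S : Submodule ℂ[X] (Localization.Away (extendS g))} (hS : IsStable S)
    {v : Fin n → ℂ} (hv : dirDeriv v g = 0) (c : ℂ[X]) (h : MvPolynomial (Fin n) ℂ)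
    (hm : algebraMap _ (Localization.Away (extendS g)) (extendS h) * algebraMap ℂ[X] _ c ∈ S) :
    algebraMap _ (Localization.Away (extendS g)) (extendS (dirDeriv v h)) *
      algebraMap ℂ[X] _ c ∈ S := by
  have h1 := S.sum_mem (t := Finset.univ) fun i _ =>
    S.smul_mem (Polynomial.C (v i)) (hS.dOp_mem i _ hm)
  convert h1 using 1
  have h2 := sum_smul_logDeriv_eq_zero hv
  have h3 : ∀ i, (Polynomial.C (v i) : ℂ[X]) • dOp g i (algebraMap _ _ (extendS h) *
      algebraMap ℂ[X] _ c) =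
      ((Polynomial.C (v i) : ℂ[X]) • logDeriv g i) * ((Polynomial.X : ℂ[X]) •
        (algebraMap _ _ (extendS h) * algebraMap ℂ[X] _ c)) +
      ((Polynomial.C (v i) : ℂ[X]) • algebraMap _ (Localization.Away (extendS g))
        (extendS (MvPolynomial.pderiv i h))) * algebraMap ℂ[X] _ c := by
    intro i
    rw [dOp_algebraMap_mul, dOp_apply, Derivation.map_algebraMap, pderiv_extendS]
    simp only [Algebra.smul_def]
    ring
  rw [Finset.sum_congr rfl fun i _ => h3 i, Finset.sum_add_distrib, ← Finset.sum_mul,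
    ← Finset.sum_mul, h2, zero_mul, zero_add, algebraMap_extendS_dirDeriv]

/-- If `u` is a product of linear forms that are nonconstant along a direction in which `g` is
constant, then `b_g` divides `b_{g u}`. -/
theorem bFunction_dvd_bFunction_mul {ι : Type*} (v : Fin n → ℂ) (hv : dirDeriv v g = 0)
    (s : Finset ι) (L : ι → MvPolynomial (Fin n) ℂ) (c : ι → ℂ) (hc : ∀ i ∈ s, c i ≠ 0)
    (hL : ∀ i ∈ s, dirDeriv v (L i) = MvPolynomial.C (c i)) (h0 : g * ∏ i ∈ s, L i ≠ 0) :
    bFunction g ∣ bFunction (g * ∏ i ∈ s, L i) := by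
  refine bFunction_dvd_bFunction_of_mem fun b hb => ?_
  obtain ⟨N, hN⟩ := exists_pow_mul_mem h0 b hb
  have hS := isStable_succSubmodule g
  -- Repeated factors become distinct indices, so that `iterate_derivation_prod` applies to `u^N`.
  have hpow : (∏ i ∈ s, L i) ^ N = ∏ q ∈ s ×ˢ Finset.range N, L q.1 := by
    rw [Finset.prod_product, ← Finset.prod_pow]
    simp
  have hit : ∀ m : ℕ, algebraMap _ (Localization.Away (extendS g))
      (extendS ((dirDeriv v)^[m] ((∏ i ∈ s, L i) ^ N))) * algebraMap ℂ[X] _ b ∈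
        succSubmodule g := by
    intro m
    induction m with
    | zero => exact hN
    | succ m ih =>
      rw [Function.iterate_succ_apply']
      exact dirDeriv_mul_mem hS hv b _ ih
  -- The order of differentiation is the number of linear factors of `u^N`, which leaves a nonzero
  -- constant.
  have h1 := hit (s ×ˢ Finset.range N).card
  rw [hpow, iterate_derivation_prod (dirDeriv v) (s ×ˢ Finset.range N) (fun q => L q.1)
    (fun q => c q.1) fun q hq => hL q.1 (Finset.mem_product.1 hq).1] at h1
  set a : ℂ := (s ×ˢ Finset.range N).card.factorial * ∏ q ∈ s ×ˢ Finset.range N, c q.1 with ha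
  have ha0 : a ≠ 0 := mul_ne_zero (Nat.cast_ne_zero.2 (Nat.factorial_ne_zero _))
    (Finset.prod_ne_zero_iff.2 fun q hq => hc q.1 (Finset.mem_product.1 hq).1)
  rw [MvPolynomial.algebraMap_eq, extendS_C] at h1
  have h2 := (succSubmodule g).smul_mem (Polynomial.C a⁻¹) h1
  have e : algebraMap (MvPolynomial (Fin n) ℂ[X]) (Localization.Away (extendS g))
      (algebraMap ℂ[X] _ (Polynomial.C a)) = algebraMap ℂ[X] _ (Polynomial.C a) :=
    (IsScalarTower.algebraMap_apply ..).symm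
  rw [e, Algebra.smul_def, ← map_mul, ← map_mul, ← mul_assoc, ← Polynomial.C_mul,
    inv_mul_cancel₀ ha0, Polynomial.C_1, one_mul] at h2
  exact h2

end Divisibility

/-! ### Splitting the Vandermonde determinant along the blocks -/

section Vandermonde

theorem xi_ne_zero (n : ℕ) : xi n ≠ 0 := by
  refine Finset.prod_ne_zero_iff.2 fun p hp => sub_ne_zero.2 fun h => ?_
  exact (Finset.mem_filter.1 hp).2.ne (MvPolynomial.X_injective h)

theorem mem_block (l : n.Partition) (t : Fin (sortedParts l).length) (i : Fin n) :
    i ∈ block l t ↔ (sortedParts l).index i = t := by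
  rw [block, ← SetLike.mem_coe, Finset.coe_map, Finset.coe_univ, Set.image_univ, eq_comm]
  exact (sortedParts l).mem_range_embedding_iff'

theorem xiPartition_eq_prod (l : n.Partition) :
    xiPartition l = ∏ p ∈ (Finset.univ : Finset (Fin n × Fin n)).filter (fun p => p.1 < p.2 ∧
      (sortedParts l).index p.1 = (sortedParts l).index p.2),
        (MvPolynomial.X p.1 - MvPolynomial.X p.2) := by
  rw [← Finset.prod_fiberwise _ (fun p => (sortedParts l).index p.1)]
  refine Finset.prod_congr rfl fun t _ => Finset.prod_congr ?_ fun _ _ => rfl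
  ext p
  simp only [Finset.mem_filter, Finset.mem_product, mem_block, Finset.mem_univ, true_and]
  constructor
  · rintro ⟨⟨h1, h2⟩, h⟩
    exact ⟨⟨h, h1.trans h2.symm⟩, h1⟩
  · rintro ⟨⟨h, h2⟩, h1⟩
    exact ⟨⟨h1, h2 ▸ h1⟩, h⟩

theorem xi_eq_xiPartition_mul (l : n.Partition) :
    xi n = xiPartition l * ∏ p ∈ (Finset.univ : Finset (Fin n × Fin n)).filter (fun p =>
      p.1 < p.2 ∧ ¬ (sortedParts l).index p.1 = (sortedParts l).index p.2),
        (MvPolynomial.X p.1 - MvPolynomial.X p.2) := by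
  rw [xiPartition_eq_prod, ← Finset.filter_filter, ← Finset.filter_filter,
    Finset.prod_filter_mul_prod_filter_not, xi, xiSet, Finset.univ_product_univ]

end Vandermonde

end BernsteinSato

end

theorem mainTheorem6 (n : ℕ) (l : n.Partition) :
    BernsteinSato.bFunction (BernsteinSato.xiPartition l) ∣
      BernsteinSato.bFunction (BernsteinSato.xi n) := by
  have h0 := BernsteinSato.xi_ne_zero n
  rw [BernsteinSato.xi_eq_xiPartition_mul l] at h0 ⊢
  -- Any vector constant on each block with distinct values on distinct blocks would do; the block
  -- index is one.
  let v : Fin n → ℂ := fun i => (((BernsteinSato.sortedParts l).index i : ℕ) : ℂ)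
  have hX : ∀ p : Fin n × Fin n, BernsteinSato.dirDeriv v
      (MvPolynomial.X p.1 - MvPolynomial.X p.2) = MvPolynomial.C (v p.1 - v p.2) := fun p => by
    rw [map_sub, BernsteinSato.dirDeriv_X, BernsteinSato.dirDeriv_X, MvPolynomial.C_sub]
  refine BernsteinSato.bFunction_dvd_bFunction_mul v ?_ _ _ (fun p => v p.1 - v p.2) ?_
    (fun p _ => hX p) h0
  · rw [BernsteinSato.xiPartition_eq_prod]
    refine BernsteinSato.derivation_prod_eq_zero _ _ _ fun p hp => ?_
    rw [hX]
    simp only [v, (Finset.mem_filter.1 hp).2.2, sub_self, map_zero]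
  · intro p hp h
    exact (Finset.mem_filter.1 hp).2.2 (Fin.ext (Nat.cast_injective (sub_eq_zero.1 h)))
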